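/- Let $E$ and $F$ be real Banach lattices. Assume that $F$ has property (d): for every sequence $(f_n)$ in $F^{*}$ with $|f_n|\wedge|f_m|=0$ for all $n\neq m$ and $f_n\to 0$ in the weak* topology, also $|f_n|\to 0$ in the weak* topology. A subset $A$ of $F$ is called almost limited if it is norm bounded and every weak* null sequence $(f_n)$ in $F^{*}$ of pairwise disjoint terms (that is, $|f_n|\wedge|f_m|=0$ for $n\ne m$) converges to zero uniformly on $A$. A bounded linear operator $T:E\to F$ is called weak almost limited if it carries every relatively weakly compact subset of $E$ to an almost limited subset of $F$. Let $S,T:E\to F$ be bounded linear operators with $0\le S\le T$, that is, $0\le Sx\le Tx$ for all $x\in E$ with $x\ge 0$. If $T$ is weak almost limited, then $S$ is weak almost limited. -/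

import Mathlib

open Filter Topology

/-!
# Weak almost limited operators between Banach lattices

A real Banach lattice is a type `E` carrying Mathlib's instances
`[NormedAddCommGroup E] [NormedSpace ℝ E] [CompleteSpace E] [Lattice E] [IsOrderedAddMonoid E]`
`[IsOrderedModule ℝ E] [HasSolidNorm E]`.

Its dual `E*` with the weak* topology is Mathlib's `WeakDual ℝ E`.  Mathlib has no lattice structure
on the dual, so it is constructed here: the order is the pointwise order on the positive cone, and
lattice operations are obtained from the Riesz-Kantorovich formula
`f⁺ x = sup {f y | 0 ≤ y ≤ x}` for `0 ≤ x`.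
-/

set_option linter.unusedSectionVars false

namespace BanachLattice

section Dual

variable {E : Type*} [NormedAddCommGroup E] [NormedSpace ℝ E] [Lattice E]
  [IsOrderedAddMonoid E] [HasSolidNorm E]

/-- The Riesz-Kantorovich supremum `sup {f y | 0 ≤ y ≤ x}` (used for `0 ≤ x`). -/
noncomputable def rieszSup (f : WeakDual ℝ E) (x : E) : ℝ := sSup (f '' Set.Icc 0 x)

theorem apply_le_of_mem_Icc (f : WeakDual ℝ E) {x y : E} (hy : y ∈ Set.Icc 0 x) :
    f y ≤ ‖WeakDual.toStrongDual f‖ * ‖x‖ := by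
  have h1 : ‖y‖ ≤ ‖x‖ := by
    apply HasSolidNorm.solid
    rw [abs_of_nonneg hy.1, abs_of_nonneg (hy.1.trans hy.2)]
    exact hy.2
  have h2 := (WeakDual.toStrongDual f).le_opNorm y
  have h3 : f y ≤ ‖WeakDual.toStrongDual f y‖ := le_abs_self _
  exact h3.trans (h2.trans (mul_le_mul_of_nonneg_left h1 (norm_nonneg _)))

theorem bddAbove_image_Icc (f : WeakDual ℝ E) (x : E) : BddAbove (f '' Set.Icc 0 x) := by
  refine ⟨‖WeakDual.toStrongDual f‖ * ‖x‖, ?_⟩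
  rintro _ ⟨y, hy, rfl⟩
  exact apply_le_of_mem_Icc f hy

theorem le_rieszSup (f : WeakDual ℝ E) {x y : E} (h0 : 0 ≤ y) (h1 : y ≤ x) :
    f y ≤ rieszSup f x :=
  le_csSup (bddAbove_image_Icc f x) ⟨y, ⟨h0, h1⟩, rfl⟩

theorem rieszSup_le (f : WeakDual ℝ E) {x : E} (hx : 0 ≤ x) {c : ℝ}
    (h : ∀ y, 0 ≤ y → y ≤ x → f y ≤ c) : rieszSup f x ≤ c := by
  refine csSup_le ⟨f 0, 0, ⟨le_rfl, hx⟩, rfl⟩ ?_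
  rintro _ ⟨y, hy, rfl⟩
  exact h y hy.1 hy.2

theorem rieszSup_nonneg (f : WeakDual ℝ E) {x : E} (hx : 0 ≤ x) : 0 ≤ rieszSup f x := by
  simpa using le_rieszSup f le_rfl hx

theorem rieszSup_add (f : WeakDual ℝ E) {a b : E} (ha : 0 ≤ a) (hb : 0 ≤ b) :
    rieszSup f (a + b) = rieszSup f a + rieszSup f b := by
  apply le_antisymm
  · refine rieszSup_le f (add_nonneg ha hb) fun y h0 h1 => ?_
    have h2 : f (y ⊓ a) ≤ rieszSup f a := le_rieszSup f (le_inf h0 ha) inf_le_right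
    have h3 : f (y - y ⊓ a) ≤ rieszSup f b := by
      refine le_rieszSup f (sub_nonneg.2 inf_le_left) ?_
      rw [sub_le_comm]
      refine le_inf (sub_le_self _ hb) ?_
      rw [sub_le_iff_le_add]
      exact h1
    have h4 : f y = f (y ⊓ a) + f (y - y ⊓ a) := by
      rw [← map_add]; congr 1; abel
    linarith
  · rw [← le_sub_iff_add_le]
    refine rieszSup_le f ha fun y h0 h1 => ?_
    rw [le_sub_comm]
    refine rieszSup_le f hb fun z g0 g1 => ?_
    rw [le_sub_iff_add_le, ← map_add]
    exact le_rieszSup f (add_nonneg g0 h0) (by rw [add_comm a b]; exact add_le_add g1 h1)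

/-- The additive extension to `E` of `rieszSup f`. -/
noncomputable def rieszFun (f : WeakDual ℝ E) (x : E) : ℝ := rieszSup f x⁺ - rieszSup f x⁻

theorem rieszFun_sub (f : WeakDual ℝ E) {a b : E} (ha : 0 ≤ a) (hb : 0 ≤ b) :
    rieszFun f (a - b) = rieszSup f a - rieszSup f b := by
  have h : (a - b)⁺ + b = a + (a - b)⁻ := by
    have := posPart_sub_negPart (a - b)
    rw [sub_eq_sub_iff_add_eq_add] at this
    exact this
  have h1 := rieszSup_add f (posPart_nonneg (a - b)) hb
  have h2 := rieszSup_add f ha (negPart_nonneg (a - b))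
  rw [h, h2] at h1
  unfold rieszFun
  linarith

theorem rieszFun_of_nonneg (f : WeakDual ℝ E) {x : E} (hx : 0 ≤ x) :
    rieszFun f x = rieszSup f x := by
  have h : rieszSup f 0 = 0 := by
    have := rieszSup_add f (le_refl (0 : E)) (le_refl (0 : E))
    rw [add_zero] at this
    linarith
  have := rieszFun_sub f hx (le_refl (0 : E))
  rwa [sub_zero, h, sub_zero] at this

theorem rieszFun_add (f : WeakDual ℝ E) (x y : E) :
    rieszFun f (x + y) = rieszFun f x + rieszFun f y := by
  have hxy : x + y = (x⁺ + y⁺) - (x⁻ + y⁻) := by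
    conv_lhs => rw [← posPart_sub_negPart x, ← posPart_sub_negPart y]
    abel
  have hx := posPart_nonneg x
  have hy := posPart_nonneg y
  have hx' := negPart_nonneg x
  have hy' := negPart_nonneg y
  rw [hxy, rieszFun_sub f (add_nonneg hx hy) (add_nonneg hx' hy'), rieszSup_add f hx hy,
    rieszSup_add f hx' hy']
  unfold rieszFun
  ring

theorem abs_rieszFun_le (f : WeakDual ℝ E) (x : E) :
    ‖rieszFun f x‖ ≤ ‖WeakDual.toStrongDual f‖ * ‖x‖ := by
  have hn : ∀ u : E, 0 ≤ u → u ≤ |x| → rieszSup f u ≤ ‖WeakDual.toStrongDual f‖ * ‖x‖ := by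
    intro u h0 h1
    refine rieszSup_le f h0 fun y g0 g1 => ?_
    have := apply_le_of_mem_Icc f (x := |x|) ⟨g0, g1.trans h1⟩
    rwa [norm_abs_eq_norm] at this
  have h1 := hn x⁺ (posPart_nonneg x) (sup_le (le_abs_self x) (abs_nonneg x))
  have h2 := hn x⁻ (negPart_nonneg x) (sup_le (neg_le_abs x) (abs_nonneg x))
  have h3 := rieszSup_nonneg f (posPart_nonneg x)
  have h4 := rieszSup_nonneg f (negPart_nonneg x)
  rw [Real.norm_eq_abs, abs_le]
  unfold rieszFun
  constructor <;> linarith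

/-- The positive part `f⁺` of a continuous linear functional `f`, as a continuous linear
functional. -/
noncomputable def dualPosPart (f : WeakDual ℝ E) : WeakDual ℝ E :=
  StrongDual.toWeakDual <|
    (AddMonoidHom.mk' (rieszFun f) (rieszFun_add f)).toRealLinearMap
      (AddMonoidHomClass.continuous_of_bound (AddMonoidHom.mk' (rieszFun f) (rieszFun_add f))
        ‖WeakDual.toStrongDual f‖ (abs_rieszFun_le f))

/-- The Riesz-Kantorovich formula for `f⁺`. -/
theorem dualPosPart_apply (f : WeakDual ℝ E) {x : E} (hx : 0 ≤ x) :
    dualPosPart f x = sSup (f '' Set.Icc 0 x) :=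
  rieszFun_of_nonneg f hx

/-- The order of the dual: `f ≤ g` iff `f x ≤ g x` for all `0 ≤ x`. -/
instance instPartialOrderDual : PartialOrder (WeakDual ℝ E) where
  le f g := ∀ x : E, 0 ≤ x → f x ≤ g x
  le_refl _ _ _ := le_rfl
  le_trans _ _ _ h1 h2 x hx := (h1 x hx).trans (h2 x hx)
  le_antisymm f g h1 h2 := by
    refine DFunLike.ext f g fun x => ?_
    have h : ∀ y : E, 0 ≤ y → f y = g y := fun y hy => le_antisymm (h1 y hy) (h2 y hy)
    rw [← posPart_sub_negPart x, map_sub, map_sub, h _ (posPart_nonneg x),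
      h _ (negPart_nonneg x)]

theorem dual_le_iff {f g : WeakDual ℝ E} : f ≤ g ↔ ∀ x : E, 0 ≤ x → f x ≤ g x := Iff.rfl

instance instIsOrderedAddMonoidDual : IsOrderedAddMonoid (WeakDual ℝ E) where
  add_le_add_left _ _ h k x hx := add_le_add_left (h x hx) (k x)

theorem le_dualPosPart (f : WeakDual ℝ E) : f ≤ dualPosPart f := by
  intro x hx
  rw [dualPosPart_apply f hx]
  exact le_rieszSup f hx le_rfl

theorem dualPosPart_nonneg (f : WeakDual ℝ E) : 0 ≤ dualPosPart f := by
  intro x hx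
  rw [dualPosPart_apply f hx]
  exact rieszSup_nonneg f hx

theorem dualPosPart_le {f g : WeakDual ℝ E} (h : f ≤ g) (h0 : 0 ≤ g) : dualPosPart f ≤ g := by
  intro x hx
  rw [dualPosPart_apply f hx]
  refine rieszSup_le f hx fun y g0 g1 => (h y g0).trans ?_
  have : (0 : ℝ) ≤ g (x - y) := h0 (x - y) (sub_nonneg.2 g1)
  rw [map_sub] at this
  exact sub_nonneg.1 this

/-- The dual of a Banach lattice is a lattice, with `f ⊔ g = f + (g - f)⁺` and
`f ⊓ g = f - (f - g)⁺`. -/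
noncomputable instance instLatticeDual : Lattice (WeakDual ℝ E) where
  __ := instPartialOrderDual
  sup f g := f + dualPosPart (g - f)
  le_sup_left _ _ := le_add_of_nonneg_right (dualPosPart_nonneg _)
  le_sup_right f g := sub_le_iff_le_add'.1 (le_dualPosPart (g - f))
  sup_le f _ _ h1 h2 := le_sub_iff_add_le'.1
    (dualPosPart_le (sub_le_sub_right h2 f) (sub_nonneg.2 h1))
  inf f g := f - dualPosPart (f - g)
  inf_le_left _ _ := sub_le_self _ (dualPosPart_nonneg _)
  inf_le_right f g := sub_le_comm.1 (le_dualPosPart (f - g))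
  le_inf _ f _ h1 h2 := le_sub_comm.1
    (dualPosPart_le (sub_le_sub_left h2 f) (sub_nonneg.2 h1))

/-- A disjoint sequence in the dual: `|f n| ⊓ |f m| = 0` for `n ≠ m`. -/
def IsDisjointSeq (f : ℕ → WeakDual ℝ E) : Prop :=
  ∀ n m, n ≠ m → |f n| ⊓ |f m| = 0

/-- A weak* null sequence in the dual. -/
def IsWeakStarNull (f : ℕ → WeakDual ℝ E) : Prop :=
  Tendsto f atTop (𝓝 0)

variable (E) in
/-- Property (d): for each disjoint weak* null sequence `f` in the dual, the sequence `|f|` is weak*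
null. -/
def PropertyD : Prop :=
  ∀ f : ℕ → WeakDual ℝ E, IsDisjointSeq f → IsWeakStarNull f → IsWeakStarNull fun n => |f n|

/-- An almost limited set: a norm bounded set on which each disjoint weak* null sequence of
functionals converges uniformly to zero. -/
def IsAlmostLimitedSet (A : Set E) : Prop :=
  Bornology.IsBounded A ∧
    ∀ f : ℕ → WeakDual ℝ E, IsDisjointSeq f → IsWeakStarNull f →
      TendstoUniformlyOn (fun n x => f n x) (fun _ => 0) atTop A

end Dual

/-- A relatively weakly compact set in a normed space: its closure in the weak topology is weakly
compact. -/
def IsRelativelyWeaklyCompact {X : Type*} [NormedAddCommGroup X] [NormedSpace ℝ X]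
    (A : Set X) : Prop :=
  IsCompact (closure (toWeakSpace ℝ X '' A))

/-- A weak almost limited operator: a bounded linear operator that carries relatively weakly compact
sets to almost limited sets. -/
def IsWeakAlmostLimited {X E : Type*} [NormedAddCommGroup X] [NormedSpace ℝ X]
    [NormedAddCommGroup E] [NormedSpace ℝ E] [Lattice E] [IsOrderedAddMonoid E] [HasSolidNorm E]
    (T : X →L[ℝ] E) : Prop :=
  ∀ A : Set X, IsRelativelyWeaklyCompact A → IsAlmostLimitedSet (T '' A)

/-- The order between operators: `S ≤ T` iff `S x ≤ T x` for all `0 ≤ x`. -/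
def OperatorLE {E F : Type*} [NormedAddCommGroup E] [NormedSpace ℝ E] [Lattice E]
    [NormedAddCommGroup F] [NormedSpace ℝ F] [Lattice F] (S T : E →L[ℝ] F) : Prop :=
  ∀ x : E, 0 ≤ x → S x ≤ T x

end BanachLattice

/-! Suppose S fails on a relatively weakly compact set A: |f_n(S x_n)| ≥ ε along a subsequence, with
x_n in A. Then |f_n|(T|x_n|) ≥ ε (`abs_apply_map_le`), and by property (d) the positive functionals
φ_n = |f_n| ∘ T are weak* null. The |x_n| need not form a relatively weakly compact set, so they are
replaced by disjoint elements y_i ≤ |x_{k i}| that keep half of the lower bound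
(`exists_disjoint_subseq`).

Disjoint positive sequences in the solid hull of A are weakly null (`tendsto_apply_of_disjoint`).
For positive f, Hahn–Banach gives functionals g_n that dominate f(y_n) at x_{k n} and satisfy ∑ |g_n
u| ≤ f|u|. Thus u ↦ (g_n u) maps into ℓ¹, where the Schur property forces g_n → 0 uniformly on A.
Hence T maps the range of y to an almost limited set, and testing it against the disjoint weak* null
sequence |f_n| contradicts the lower bound. -/

namespace BanachLattice

/-! ### Disjointness in lattice-ordered groups and vector lattices -/

section LatticeGroup

variable {G : Type*} [Lattice G] [AddCommGroup G] [IsOrderedAddMonoid G]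

theorem add_inf_le_inf_add_inf {a b c : G} (ha : 0 ≤ a) (hb : 0 ≤ b) (hc : 0 ≤ c) :
    (a + b) ⊓ c ≤ a ⊓ c + b ⊓ c := by
  rw [inf_add, add_inf, add_inf]
  refine le_inf (le_inf inf_le_left ?_) (le_inf ?_ ?_)
  · exact inf_le_right.trans (le_add_of_nonneg_left ha)
  · exact inf_le_right.trans (le_add_of_nonneg_right hb)
  · exact inf_le_right.trans (le_add_of_nonneg_left hc)

theorem add_le_of_inf_eq_zero {a b u : G} (hab : a ⊓ b = 0) (ha : a ≤ u) (hb : b ≤ u) :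
    a + b ≤ u := by
  rw [← inf_add_sup, hab, zero_add]
  exact sup_le ha hb

theorem sum_inf_eq_zero {ι : Type*} (s : Finset ι) (e : ι → G) (c : G) (he : ∀ i, 0 ≤ e i)
    (hc : 0 ≤ c) (h : ∀ i ∈ s, e i ⊓ c = 0) : (∑ i ∈ s, e i) ⊓ c = 0 := by
  classical
  induction s using Finset.induction_on with
  | empty => simpa using hc
  | insert i s hi ih =>
    rw [Finset.sum_insert hi]
    refine le_antisymm ?_ (le_inf (add_nonneg (he i) (Finset.sum_nonneg fun j _ => he j)) hc)
    refine (add_inf_le_inf_add_inf (he i) (Finset.sum_nonneg fun j _ => he j) hc).trans ?_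
    rw [h i (Finset.mem_insert_self i s), ih fun j hj => h j (Finset.mem_insert_of_mem hj),
      add_zero]

theorem sum_le_of_pairwise_inf_eq_zero {ι : Type*} (s : Finset ι) (e : ι → G) (u : G)
    (hu : 0 ≤ u) (he : ∀ i, 0 ≤ e i) (hle : ∀ i, e i ≤ u)
    (h : Pairwise fun i j => e i ⊓ e j = 0) : ∑ i ∈ s, e i ≤ u := by
  classical
  induction s using Finset.induction_on with
  | empty => simpa using hu
  | insert i s hi ih =>
    rw [Finset.sum_insert hi, add_comm]
    refine add_le_of_inf_eq_zero (sum_inf_eq_zero s e _ he (he i) fun j hj => h ?_) ih (hle i)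
    rintro rfl
    exact hi hj

end LatticeGroup

theorem real_smul_inf {E : Type*} [AddCommGroup E] [Module ℝ E] [Lattice E]
    [IsOrderedAddMonoid E] [IsOrderedModule ℝ E] {c : ℝ} (hc : 0 < c) (a b : E) :
    c • (a ⊓ b) = (c • a) ⊓ (c • b) :=
  (OrderIso.smulRight hc).map_inf a b

theorem abs_real_smul {E : Type*} [AddCommGroup E] [Module ℝ E] [Lattice E]
    [IsOrderedAddMonoid E] [IsOrderedModule ℝ E] {c : ℝ} (hc : 0 < c) (a : E) :
    |c • a| = c • |a| := by
  have h : c • (a ⊔ -a) = (c • a) ⊔ (c • -a) := (OrderIso.smulRight hc).map_sup a (-a)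
  rw [smul_neg] at h
  exact h.symm

theorem smul_inf_smul_eq_zero {E : Type*} [AddCommGroup E] [Module ℝ E] [Lattice E]
    [IsOrderedAddMonoid E] [IsOrderedModule ℝ E] {a b : E} (hab : a ⊓ b = 0) {t : ℝ}
    (ht : 0 ≤ t) : (t • a) ⊓ (t • b) = 0 := by
  rcases ht.eq_or_lt with rfl | ht
  · simp
  · rw [← real_smul_inf ht, hab, smul_zero]

/-! ### The Schur property and relatively weakly compact sets -/

/-- A form of the Schur property of `ℓ¹`, obtained from the Baire property of the Cantor space. -/
theorem eventually_abs_diag_le {a : ℕ → ℕ → ℝ} (ha : ∀ n, Summable fun i => |a n i|)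
    (h : ∀ s : ℕ → Bool, Tendsto (fun n => ∑' i, (if s i then a n i else 0)) atTop (𝓝 0))
    {ε : ℝ} (hε : 0 < ε) : ∃ N, ∀ n ≥ N, ∀ i ≥ N, |a n i| ≤ ε := by
  set H : ℕ → (ℕ → Bool) → ℝ := fun n s => ∑' i, (if s i then a n i else 0) with hH
  have hcont : ∀ n, Continuous (H n) := by
    intro n
    refine continuous_tsum (u := fun i => |a n i|) (fun i => ?_) (ha n) fun i s => ?_
    · exact (continuous_of_discreteTopology (f := fun b : Bool => if b then a n i else 0)).comp
        (continuous_apply i)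
    · split_ifs <;> simp
  have hsum : ∀ n (s : ℕ → Bool), Summable fun i => if s i then a n i else 0 := by
    intro n s
    refine Summable.of_norm_bounded (ha n) fun i => ?_
    split_ifs <;> simp
  -- These closed sets cover the Cantor space, so one contains a cylinder, which fixes only finitely
  -- many coordinates.
  obtain ⟨N, s, hs⟩ := nonempty_interior_of_iUnion_of_closed
    (f := fun N : ℕ => {s | ∀ n ≥ N, |H n s| ≤ ε / 2})
    (fun N => by
      simp only [Set.ofPred_forall]
      exact isClosed_iInter fun n => isClosed_iInter fun _ =>
        isClosed_le (hcont n).abs continuous_const)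
    (by
      refine Set.eq_univ_of_forall fun s => Set.mem_iUnion.2 ?_
      have := (h s).abs.eventually_le_const (u := ε / 2) (by simpa using half_pos hε)
      exact eventually_atTop.1 this)
  rw [mem_interior_iff_mem_nhds, nhds_pi, Filter.mem_pi] at hs
  obtain ⟨I, hI, t, ht, hsub⟩ := hs
  obtain ⟨M, hM⟩ := hI.bddAbove
  -- Coordinates beyond `M` are free: flipping the `i`-th stays in the cylinder and changes `H n` by
  -- exactly `a n i`.
  refine ⟨max N (M + 1), fun n hn i hi => ?_⟩
  have hmem : ∀ b : Bool, |H n (Function.update s i b)| ≤ ε / 2 := by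
    intro b
    refine hsub ?_ n (le_of_max_le_left hn)
    intro j hj
    have : j ≠ i := by
      have := hM hj
      have := le_of_max_le_right hi
      omega
    rw [Function.update_of_ne this]
    exact mem_of_mem_nhds (ht j)
  have hdiff : H n (Function.update s i true) - H n (Function.update s i false) = a n i := by
    simp only [hH]
    rw [← (hsum n _).tsum_sub (hsum n _), tsum_eq_single i]
    · simp
    · intro j hj
      simp [Function.update_of_ne hj]
  rw [← hdiff]
  have h1 := abs_le.1 (hmem true)
  have h2 := abs_le.1 (hmem false)
  rw [abs_le]
  constructor <;> linarith

section WeaklyCompact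

variable {X : Type*} [NormedAddCommGroup X] [NormedSpace ℝ X]

theorem continuous_weakSpace_apply (f : X →L[ℝ] ℝ) :
    Continuous fun x : WeakSpace ℝ X => f ((toWeakSpace ℝ X).symm x) :=
  WeakBilin.eval_continuous (topDualPairing ℝ X).flip f

theorem tendsto_toWeakSpace_iff {x : ℕ → X} {a : X} :
    Tendsto (fun n => toWeakSpace ℝ X (x n)) atTop (𝓝 (toWeakSpace ℝ X a)) ↔
      ∀ f : X →L[ℝ] ℝ, Tendsto (fun n => f (x n)) atTop (𝓝 (f a)) := by
  refine ⟨fun h f => ?_, fun h => ?_⟩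
  · exact ((continuous_weakSpace_apply f).tendsto _).comp h
  · refine (WeakBilin.tendsto_iff_forall_eval_tendsto (topDualPairing ℝ X).flip ?_).2 h
    intro u v huv
    refine (NormedSpace.inclusionInDoubleDualLi (E := X) ℝ).injective ?_
    ext f
    exact LinearMap.congr_fun huv f

theorem isRelativelyWeaklyCompact_range {x : ℕ → X}
    (h : ∀ f : X →L[ℝ] ℝ, Tendsto (fun n => f (x n)) atTop (𝓝 0)) :
    IsRelativelyWeaklyCompact (Set.range x) := by
  have h1 : Tendsto (fun n => toWeakSpace ℝ X (x n)) atTop (𝓝 (toWeakSpace ℝ X 0)) :=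
    tendsto_toWeakSpace_iff.2 fun f => by simpa using h f
  refine h1.isCompact_insert_range.closure_of_subset ?_
  rintro _ ⟨_, ⟨n, rfl⟩, rfl⟩
  exact Or.inr ⟨n, rfl⟩

theorem IsRelativelyWeaklyCompact.isBounded {A : Set X} (hA : IsRelativelyWeaklyCompact A) :
    Bornology.IsBounded A := by
  have h : ∀ f : StrongDual ℝ X, ∃ C, ∀ x : A,
      ‖NormedSpace.inclusionInDoubleDualLi (E := X) ℝ (x : X) f‖ ≤ C := by
    intro f
    obtain ⟨C, hC⟩ := (hA.image (continuous_weakSpace_apply f)).isBounded.exists_norm_le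
    exact ⟨C, fun x => hC _ ⟨_, subset_closure ⟨x, x.2, rfl⟩, rfl⟩⟩
  obtain ⟨C, hC⟩ := banach_steinhaus h
  refine isBounded_iff_forall_norm_le.2 ⟨C, fun x hx => ?_⟩
  exact ((NormedSpace.inclusionInDoubleDualLi (E := X) ℝ).norm_map x).ge.trans (hC ⟨x, hx⟩)

/-- The functional `∑ g i` over the indices selected by `s`, for a sequence `g` of functionals
whose sums `∑ |g i u|` are bounded by `C * ‖u‖`. -/
theorem exists_tsum_functional {g : ℕ → X →L[ℝ] ℝ} {C : ℝ} (hs : ∀ u, Summable fun i => |g i u|)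
    (hC : ∀ u, ∑' i, |g i u| ≤ C * ‖u‖) (s : ℕ → Bool) :
    ∃ h : X →L[ℝ] ℝ, ∀ u, h u = ∑' i, (if s i then g i u else 0) := by
  have hsum : ∀ u, Summable fun i => if s i then g i u else 0 := by
    intro u
    refine Summable.of_norm_bounded (hs u) fun i => ?_
    split_ifs <;> simp
  let L : X →ₗ[ℝ] ℝ :=
    { toFun := fun u => ∑' i, (if s i then g i u else 0)
      map_add' := fun u v => by
        rw [← (hsum u).tsum_add (hsum v)]
        refine tsum_congr fun i => ?_
        split_ifs <;> simp
      map_smul' := fun c u => by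
        simp only [RingHom.id_apply, smul_eq_mul]
        rw [← tsum_mul_left]
        refine tsum_congr fun i => ?_
        split_ifs <;> simp }
  refine ⟨L.mkContinuous C fun u => ?_, fun u => rfl⟩
  refine le_trans ?_ (hC u)
  refine tsum_of_norm_bounded (hs u).hasSum fun i => ?_
  split_ifs <;> simp

/-- The map u ↦ (g i u) is bounded into ℓ¹, and subset sums of the g i are again continuous
functionals. Weak convergence tested on these sums is what the Schur argument needs. -/
theorem tendsto_apply_of_isRelativelyWeaklyCompact {A : Set X} (hA : IsRelativelyWeaklyCompact A)
    {g : ℕ → X →L[ℝ] ℝ} {C : ℝ} (hs : ∀ u, Summable fun i => |g i u|)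
    (hC : ∀ u, ∑' i, |g i u| ≤ C * ‖u‖) {z : ℕ → X} (hz : ∀ n, z n ∈ A) :
    Tendsto (fun n => g n (z n)) atTop (𝓝 0) := by
  refine tendsto_of_subseq_tendsto fun ns hns => ?_
  set G : WeakSpace ℝ X → ℕ → ℝ := fun x i => g i ((toWeakSpace ℝ X).symm x) with hG
  have hGc : Continuous G := continuous_pi fun i => continuous_weakSpace_apply (g i)
  have hmem : ∀ n, toWeakSpace ℝ X (z n) ∈ closure (toWeakSpace ℝ X '' A) :=
    fun n => subset_closure ⟨z n, hz n, rfl⟩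
  -- The image under `G` is compact in the metrizable space ℝ^ℕ, so a coordinatewise convergent
  -- subsequence exists without Eberlein–Šmulian.
  obtain ⟨_, ⟨z₀, -, rfl⟩, ms, hms, hlim⟩ := (hA.image hGc).tendsto_subseq
    (x := fun n => G (toWeakSpace ℝ X (z (ns n)))) fun n => ⟨_, hmem _, rfl⟩
  refine ⟨ms, ?_⟩
  set x₀ : X := (toWeakSpace ℝ X).symm z₀ with hx₀
  set w : ℕ → X := fun n => z (ns (ms n)) with hw
  have hconv : ∀ s : ℕ → Bool,
      Tendsto (fun n => ∑' i, (if s i then g i (w n - x₀) else 0)) atTop (𝓝 0) := by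
    intro s
    obtain ⟨h, hh⟩ := exists_tsum_functional hs hC s
    rw [show (fun n => ∑' i, (if s i then g i (w n - x₀) else 0)) = fun n => h (w n) - h x₀ from
      funext fun n => by rw [← hh, map_sub], ← sub_self (h x₀)]
    refine Tendsto.sub ?_ tendsto_const_nhds
    refine (tendsto_iff_ultrafilter _ _ _).2 fun U hU => ?_
    obtain ⟨z', -, hz'⟩ := isCompact_iff_ultrafilter_le_nhds.1 hA
      (U.map fun n => toWeakSpace ℝ X (w n))
      (by
        rw [Ultrafilter.coe_map]
        exact tendsto_principal.2 (Eventually.of_forall fun n => hmem _))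
    rw [Ultrafilter.coe_map] at hz'
    -- The weak cluster point `z'` may differ from `z₀`, but all g i agree on them, hence so does
    -- `h`.
    have hGz : G z' = G z₀ :=
      tendsto_nhds_unique ((hGc.tendsto z').comp hz') (hlim.mono_left hU)
    have heq : h x₀ = h ((toWeakSpace ℝ X).symm z') := by
      rw [hh, hh]
      refine tsum_congr fun i => ?_
      rw [show g i ((toWeakSpace ℝ X).symm z') = g i x₀ from congrFun hGz i]
    rw [heq]
    exact ((continuous_weakSpace_apply h).tendsto z').comp hz'
  have hdiag : Tendsto (fun n => g (ns (ms n)) (w n - x₀)) atTop (𝓝 0) := by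
    rw [Metric.tendsto_atTop]
    intro ε hε
    obtain ⟨N, hN⟩ := eventually_abs_diag_le (a := fun n i => g i (w n - x₀))
      (fun n => hs _) hconv (half_pos hε)
    have hev := (hns.comp hms.tendsto_atTop).eventually_ge_atTop N
    obtain ⟨M, hM⟩ := eventually_atTop.1 hev
    refine ⟨max N M, fun n hn => ?_⟩
    rw [Real.dist_0_eq_abs]
    exact (hN n (le_of_max_le_left hn) _ (hM n (le_of_max_le_right hn))).trans_lt (half_lt_self hε)
  have h0 : Tendsto (fun n => g (ns (ms n)) x₀) atTop (𝓝 0) :=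
    (hs x₀).of_abs.tendsto_atTop_zero.comp (hns.comp hms.tendsto_atTop)
  simpa using hdiag.add h0

end WeaklyCompact

/-- Hahn–Banach, extending c • z ↦ c * p z from the line through z. -/
theorem exists_linearMap_eq_seminorm {X : Type*} [AddCommGroup X] [Module ℝ X] (p : Seminorm ℝ X)
    (z : X) : ∃ g : X →ₗ[ℝ] ℝ, g z = p z ∧ ∀ x, |g x| ≤ p x := by
  have H : ∀ c : ℝ, c • z = 0 → c • p z = 0 := by
    intro c hc
    rcases smul_eq_zero.1 hc with rfl | rfl <;> simp
  obtain ⟨g, hg, hle⟩ := exists_extension_of_le_sublinear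
    (LinearPMap.mkSpanSingleton' (σ := RingHom.id ℝ) z (p z) H) p
    (fun c hc x => by rw [map_smul_eq_mul, Real.norm_of_nonneg hc.le])
    (fun x y => map_add_le_add p x y)
    (by
      rintro ⟨x, hx⟩
      obtain ⟨c, rfl⟩ := Submodule.mem_span_singleton.1 hx
      rw [LinearPMap.mkSpanSingleton'_apply]
      simp only [RingHom.id_apply, smul_eq_mul, map_smul_eq_mul]
      exact mul_le_mul_of_nonneg_right (le_abs_self c) (apply_nonneg p z))
  refine ⟨g, ?_, fun x => abs_le.2 ⟨?_, hle x⟩⟩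
  · have hz : z ∈ (LinearPMap.mkSpanSingleton' (σ := RingHom.id ℝ) z (p z) H).domain :=
      Submodule.mem_span_singleton_self z
    have := hg ⟨z, hz⟩
    rwa [LinearPMap.mkSpanSingleton'_apply_self] at this
  · have := hle (-x)
    rw [map_neg, map_neg_eq_map] at this
    linarith

/-! ### Band components of functionals and disjoint sequences -/

section Lattice

variable {E : Type*} [NormedAddCommGroup E] [NormedSpace ℝ E] [Lattice E]
  [IsOrderedAddMonoid E] [IsOrderedModule ℝ E] [HasSolidNorm E]

theorem map_le_map_of_nonneg {f : E →L[ℝ] ℝ} (hf : ∀ x, 0 ≤ x → 0 ≤ f x) {x y : E} (h : x ≤ y) :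
    f x ≤ f y := by
  have := hf _ (sub_nonneg.2 h)
  rw [map_sub] at this
  linarith

/-- The supremum of `f (|u| ⊓ t • y)` over `0 ≤ t`: for positive `f` and `y`, the value at `|u|` of
the component of `f` carried by the principal band of `y`. -/
noncomputable def bandSup (f : E →L[ℝ] ℝ) (y u : E) : ℝ :=
  ⨆ t : NNReal, f (|u| ⊓ (t : ℝ) • y)

variable {f : E →L[ℝ] ℝ} (hf : ∀ x, 0 ≤ x → 0 ≤ f x) {y : E}

include hf in
theorem bddAbove_bandSup (y u : E) :
    BddAbove (Set.range fun t : NNReal => f (|u| ⊓ (t : ℝ) • y)) := by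
  refine ⟨f |u|, ?_⟩
  rintro _ ⟨t, rfl⟩
  exact map_le_map_of_nonneg hf inf_le_left

include hf in
theorem le_bandSup (y u : E) {t : ℝ} (ht : 0 ≤ t) : f (|u| ⊓ t • y) ≤ bandSup f y u :=
  le_ciSup (bddAbove_bandSup hf y u) ⟨t, ht⟩

include hf in
theorem tendsto_bandSup (hy : 0 ≤ y) (u : E) :
    Tendsto (fun t : NNReal => f (|u| ⊓ (t : ℝ) • y)) atTop (𝓝 (bandSup f y u)) := by
  refine tendsto_atTop_ciSup (fun s t hst => map_le_map_of_nonneg hf ?_)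
    (bddAbove_bandSup hf y u)
  exact inf_le_inf_left _ (smul_le_smul_of_nonneg_right (by exact_mod_cast hst) hy)

theorem bandSup_zero (hy : 0 ≤ y) : bandSup f y 0 = 0 := by
  have h : ∀ t : NNReal, f (|(0 : E)| ⊓ (t : ℝ) • y) = 0 := by
    intro t
    rw [abs_zero, inf_eq_left.2 (smul_nonneg t.coe_nonneg hy), map_zero]
  simp only [bandSup, h, ciSup_const]

/-- `bandSup f y` as a seminorm. -/
noncomputable def bandSeminorm (hf : ∀ x, 0 ≤ x → 0 ≤ f x) (hy : 0 ≤ y) : Seminorm ℝ E :=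
  Seminorm.ofSMulLE (bandSup f y)
    (bandSup_zero hy)
    (fun u v => by
      refine ciSup_le fun t => ?_
      have ht : 0 ≤ (t : ℝ) • y := smul_nonneg t.2 hy
      refine le_trans ?_ (add_le_add (le_bandSup hf y u t.2) (le_bandSup hf y v t.2))
      rw [← map_add]
      refine map_le_map_of_nonneg hf ((inf_le_inf_right _ (abs_add_le u v)).trans ?_)
      exact add_inf_le_inf_add_inf (abs_nonneg u) (abs_nonneg v) ht)
    (fun c u => by
      rcases eq_or_ne c 0 with rfl | hc
      · simp [bandSup_zero hy]
      have hc' : 0 < |c| := abs_pos.2 hc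
      have habs : |c • u| = |c| • |u| := by
        rcases abs_choice c with h | h
        · rw [← abs_real_smul hc', h]
        · rw [← abs_real_smul hc', h, neg_smul, abs_neg]
      refine ciSup_le fun t => ?_
      have ht : (t : ℝ) • y = |c| • ((t / |c| : ℝ) • y) := by
        rw [smul_smul, mul_div_cancel₀ _ hc'.ne']
      rw [habs, ht, ← real_smul_inf hc', map_smul, smul_eq_mul, Real.norm_eq_abs]
      exact mul_le_mul_of_nonneg_left (le_bandSup hf y u (div_nonneg t.2 hc'.le)) hc'.le)

include hf in
-- At a fixed level t the elements |u| ⊓ t • y n are disjoint and below |u|, so their sum is below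
-- |u|. Then t tends to infinity.
theorem sum_bandSup_le {y : ℕ → E} (hy : ∀ n, 0 ≤ y n)
    (hd : Pairwise fun n m => y n ⊓ y m = 0) (s : Finset ℕ) (u : E) :
    ∑ n ∈ s, bandSup f (y n) u ≤ f |u| := by
  refine le_of_tendsto (tendsto_finsetSum s fun n _ => tendsto_bandSup hf (hy n) u)
    (Eventually.of_forall fun t => ?_)
  rw [← map_sum]
  have hnn : ∀ n, 0 ≤ |u| ⊓ (t : ℝ) • y n := fun n =>
    le_inf (abs_nonneg u) (smul_nonneg t.2 (hy n))
  refine map_le_map_of_nonneg hf (sum_le_of_pairwise_inf_eq_zero s _ _ (abs_nonneg u) hnn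
    (fun n => inf_le_left) fun n m hnm => le_antisymm ?_ (le_inf (hnn n) (hnn m)))
  exact (inf_le_inf inf_le_right inf_le_right).trans (smul_inf_smul_eq_zero (hd hnm) t.2).le

theorem apply_abs_le_of_nonneg (f : E →L[ℝ] ℝ) (u : E) : f |u| ≤ ‖f‖ * ‖u‖ := by
  have := f.le_opNorm |u|
  rw [norm_abs_eq_norm] at this
  exact (le_abs_self _).trans this

include hf in
theorem exists_functional_bandSup (hy : 0 ≤ y) {z : E} (hyz : y ≤ |z|) :
    ∃ g : E →L[ℝ] ℝ, f y ≤ g z ∧ ∀ u, |g u| ≤ bandSup f y u := by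
  obtain ⟨g, hgz, hg⟩ := exists_linearMap_eq_seminorm (bandSeminorm hf hy) z
  have hg' : ∀ u, |g u| ≤ bandSup f y u := hg
  refine ⟨g.mkContinuous ‖f‖ fun u => ?_, ?_, hg'⟩
  · refine (hg' u).trans ((ciSup_le fun t => ?_).trans (apply_abs_le_of_nonneg f u))
    exact map_le_map_of_nonneg hf inf_le_left
  · change f y ≤ g z
    rw [hgz]
    have := le_bandSup hf y z zero_le_one
    rwa [one_smul, inf_eq_right.2 hyz] at this

/-- A disjoint sequence in the solid hull of a relatively weakly compact set is weakly null, for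
positive sequences. -/
theorem tendsto_apply_of_disjoint {A : Set E} (hA : IsRelativelyWeaklyCompact A) {y z : ℕ → E}
    (hz : ∀ n, z n ∈ A) (hy : ∀ n, 0 ≤ y n) (hyz : ∀ n, y n ≤ |z n|)
    (hd : Pairwise fun n m => y n ⊓ y m = 0) (f : E →L[ℝ] ℝ) :
    Tendsto (fun n => f (y n)) atTop (𝓝 0) := by
  have key : ∀ f : E →L[ℝ] ℝ, (∀ x, 0 ≤ x → 0 ≤ f x) →
      Tendsto (fun n => f (y n)) atTop (𝓝 0) := by
    intro f hf
    choose g hgz hg using fun n => exists_functional_bandSup hf (hy n) (hyz n)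
    have hsum : ∀ u (s : Finset ℕ), ∑ i ∈ s, |g i u| ≤ ‖f‖ * ‖u‖ := fun u s =>
      ((Finset.sum_le_sum fun i _ => hg i u).trans (sum_bandSup_le hf hy hd s u)).trans
        (apply_abs_le_of_nonneg f u)
    exact squeeze_zero (fun n => hf _ (hy n)) hgz
      (tendsto_apply_of_isRelativelyWeaklyCompact hA
        (fun u => summable_of_sum_le (fun i => abs_nonneg _) (hsum u))
        (fun u => Real.tsum_le_of_sum_le (fun i => abs_nonneg _) (hsum u)) hz)
  -- Reduction to positive functionals: f = f⁺ - (f⁺ - f).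
  set p : WeakDual ℝ E := dualPosPart (StrongDual.toWeakDual f) with hp
  have h1 : ∀ x : E, 0 ≤ x → 0 ≤ p x := dualPosPart_nonneg _
  have h2 : ∀ x : E, 0 ≤ x → f x ≤ p x := le_dualPosPart (StrongDual.toWeakDual f)
  have := (key (WeakDual.toStrongDual p) h1).sub (key (WeakDual.toStrongDual p - f) fun x hx =>
    sub_nonneg.2 (h2 x hx))
  simpa using this

end Lattice

/-! ### Extraction of disjoint sequences -/

section Extraction

variable {E : Type*} [NormedAddCommGroup E] [NormedSpace ℝ E] [CompleteSpace E] [Lattice E]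
  [IsOrderedAddMonoid E] [IsOrderedModule ℝ E] [HasSolidNorm E]

/-- Since b - r⁻¹ • a = -r⁻¹ • (a - r • b) and r⁻¹ ≤ 1, the elements v⁺ and w⁺ lie below the
positive and negative parts of the single element a - r • b. -/
theorem posPart_inf_posPart_eq_zero {a b v w : E} {r : ℝ} (hr : 1 ≤ r) (hv : v ≤ a - r • b)
    (hw : w ≤ b - r⁻¹ • a) : v⁺ ⊓ w⁺ = 0 := by
  have hr0 : 0 < r := zero_lt_one.trans_le hr
  refine le_antisymm ?_ (le_inf (posPart_nonneg v) (posPart_nonneg w))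
  rw [← posPart_inf_negPart_eq_zero (a - r • b)]
  have hn := negPart_nonneg (a - r • b)
  refine inf_le_inf (posPart_mono hv) (sup_le (hw.trans ?_) hn)
  have h1 : b - r⁻¹ • a = r⁻¹ • -(a - r • b) := by
    rw [neg_sub, smul_sub, smul_smul, inv_mul_cancel₀ hr0.ne', one_smul]
  rw [h1]
  calc r⁻¹ • -(a - r • b) ≤ r⁻¹ • (a - r • b)⁻ :=
        smul_le_smul_of_nonneg_left (neg_le_negPart _) (inv_nonneg.2 hr0.le)
    _ ≤ (1 : ℝ) • (a - r • b)⁻ := smul_le_smul_of_nonneg_right (inv_le_one_of_one_le₀ hr) hn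
    _ = (a - r • b)⁻ := one_smul _ _

/-- If positive functionals `φ n` tend to zero pointwise but not along a bounded positive sequence,
then they do not tend to zero along a disjoint sequence lying below a subsequence. -/
theorem exists_disjoint_subseq {φ : ℕ → E →L[ℝ] ℝ} (hφ : ∀ n x, 0 ≤ x → 0 ≤ φ n x)
    (hφ0 : ∀ x, Tendsto (fun n => φ n x) atTop (𝓝 0)) {z : ℕ → E} (hz : ∀ n, 0 ≤ z n) {M : ℝ}
    (hM : ∀ n, ‖z n‖ ≤ M) {ε : ℝ} (hε : 0 < ε) (h : ∀ n, ε ≤ φ n (z n)) :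
    ∃ k : ℕ → ℕ, StrictMono k ∧ ∃ y : ℕ → E, (∀ i, 0 ≤ y i) ∧ (∀ i, y i ≤ z (k i)) ∧
      (Pairwise fun i j => y i ⊓ y j = 0) ∧ ∀ᶠ i in atTop, ε / 2 ≤ φ (k i) (y i) := by
  set B : ℕ → E := fun n => (4 : ℝ) ^ n • ∑ j ∈ Finset.range (n + 1), z j with hB
  have hB0 : ∀ n, 0 ≤ B n := fun n =>
    smul_nonneg (by positivity) (Finset.sum_nonneg fun j _ => hz j)
  have hev : ∀ n, ∃ N, ∀ m ≥ N, φ m (B n) ≤ ε / 4 := fun n =>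
    eventually_atTop.1 ((hφ0 (B n)).eventually_le_const (by positivity))
  choose N hN using hev
  -- Each index is so large that its functional is at most ε/4 on `B` of the previous one. Every
  -- term needs a predecessor, hence the shift to k (i + 1) below.
  let k : ℕ → ℕ := fun i => Nat.rec 0 (fun _ a => max (N a) (a + 1)) i
  have hks : ∀ i, k (i + 1) = max (N (k i)) (k i + 1) := fun i => rfl
  have hkm : StrictMono k := strictMono_nat_of_lt_succ fun i => by
    rw [hks]; exact (Nat.lt_succ_self _).trans_le (le_max_right _ _)
  set a : ℕ → E := fun i => z (k (i + 1)) with ha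
  have hsum : Summable fun i => (1 / 2 : ℝ) ^ i • a i := by
    refine Summable.of_norm_bounded (summable_geometric_two.mul_right M) fun i => ?_
    rw [norm_smul, Real.norm_of_nonneg (by positivity)]
    exact mul_le_mul_of_nonneg_left (hM _) (by positivity)
  set x : E := ∑' i, (1 / 2 : ℝ) ^ i • a i with hx
  have hxa : ∀ i, (1 / 2 : ℝ) ^ i • a i ≤ x := fun i =>
    hsum.le_tsum i fun j _ => smul_nonneg (by positivity) (hz _)
  have hx0 : 0 ≤ x := (smul_nonneg (by positivity) (hz _)).trans (hxa 0)
  -- Subtracting `B (k i)` gives disjointness from earlier terms, as 4 ^ k m ≥ 2 ^ (n + m) for n <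
  -- m. Subtracting the multiple of `x` gives it from later ones, as (1/2)^n • x ≥ (1/2)^(n + m) • a
  -- m.
  set v : ℕ → E := fun i => a i - B (k i) - (1 / 2 : ℝ) ^ i • x with hv
  have hxi : ∀ i, 0 ≤ (1 / 2 : ℝ) ^ i • x := fun i => smul_nonneg (by positivity) hx0
  have hdisj : ∀ n m, n < m → (v m)⁺ ⊓ (v n)⁺ = 0 := by
    intro n m hnm
    refine posPart_inf_posPart_eq_zero (a := a m) (b := a n) (r := 2 ^ (n + m))
      (one_le_pow₀ one_le_two) ?_ ?_
    · refine (sub_le_self _ (hxi m)).trans (sub_le_sub_left ?_ _)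
      refine _root_.smul_le_smul ?_ ?_ (by positivity) (Finset.sum_nonneg fun j _ => hz j)
      · calc (2 : ℝ) ^ (n + m) ≤ 2 ^ (2 * k m) := by
              refine pow_le_pow_right₀ one_le_two ?_
              have := hkm.le_apply (x := m)
              omega
          _ = 4 ^ k m := by rw [pow_mul]; norm_num
      · refine Finset.single_le_sum (f := z) (fun j _ => hz j) (Finset.mem_range.2 ?_)
        exact Nat.lt_succ_of_le (hkm.monotone hnm)
    · refine (sub_le_sub_right (sub_le_self _ (hB0 _)) _).trans (sub_le_sub_left ?_ _)
      have := smul_le_smul_of_nonneg_left (hxa m) (by positivity : (0 : ℝ) ≤ (1 / 2) ^ n)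
      rwa [smul_smul, ← pow_add, show ((1 / 2 : ℝ) ^ (n + m)) = (2 ^ (n + m))⁻¹ by rw [one_div, inv_pow]] at this
  refine ⟨fun i => k (i + 1), fun i j hij => hkm (Nat.succ_lt_succ hij), fun i => (v i)⁺,
    fun i => posPart_nonneg _, fun i => ?_, fun i j hij => ?_, ?_⟩
  · exact sup_le ((sub_le_self _ (hxi i)).trans (sub_le_self _ (hB0 _))) (hz _)
  · rcases hij.lt_or_gt with hlt | hlt
    · rw [inf_comm]; exact hdisj i j hlt
    · exact hdisj j i hlt
  · have hk1 : Tendsto (fun i => k (i + 1)) atTop atTop :=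
      hkm.tendsto_atTop.comp (tendsto_add_atTop_nat 1)
    -- The two subtracted terms cost at most ε/4 each, leaving ε/2.
    filter_upwards [((hφ0 x).comp hk1).eventually_le_const (by positivity : (0 : ℝ) < ε / 4)]
      with i hi
    have h1 : φ (k (i + 1)) (v i) ≤ φ (k (i + 1)) (v i)⁺ :=
      map_le_map_of_nonneg (hφ _) (le_posPart _)
    have h2 : φ (k (i + 1)) (B (k i)) ≤ ε / 4 := hN _ _ (by rw [hks]; exact le_max_left _ _)
    have h3 := h (k (i + 1))
    have h4 : (1 / 2 : ℝ) ^ i * φ (k (i + 1)) x ≤ 1 * φ (k (i + 1)) x :=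
      mul_le_mul_of_nonneg_right (pow_le_one₀ (by norm_num) (by norm_num)) (hφ _ x hx0)
    have hi' : φ (k (i + 1)) x ≤ ε / 4 := hi
    have h5 : φ (k (i + 1)) (v i) = φ (k (i + 1)) (z (k (i + 1))) - φ (k (i + 1)) (B (k i)) -
        (1 / 2 : ℝ) ^ i * φ (k (i + 1)) x := by
      simp only [hv, ha, map_sub, map_smul, smul_eq_mul]
    linarith

end Extraction

/-! ### Moduli of functionals and the domination estimate -/

section Dual

variable {F : Type*} [NormedAddCommGroup F] [NormedSpace ℝ F] [Lattice F]
  [IsOrderedAddMonoid F] [HasSolidNorm F]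

theorem IsWeakStarNull.tendsto_apply {f : ℕ → WeakDual ℝ F} (hf : IsWeakStarNull f) (x : F) :
    Tendsto (fun n => f n x) atTop (𝓝 0) :=
  ((WeakDual.eval_continuous x).tendsto 0).comp hf

theorem dual_abs_nonneg (f : WeakDual ℝ F) {x : F} (hx : 0 ≤ x) : 0 ≤ |f| x :=
  dual_le_iff.1 (abs_nonneg f) x hx

/-- On the positive cone, ±f(Su) ≤ |f|(Su) ≤ |f|(Tu). Splitting x into x⁺ and x⁻, with |x| = x⁺ +
x⁻, gives the general case. -/
theorem abs_apply_map_le {E : Type*} [NormedAddCommGroup E] [NormedSpace ℝ E] [Lattice E]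
    [IsOrderedAddMonoid E] {S T : E →L[ℝ] F} (hS : OperatorLE 0 S) (hST : OperatorLE S T)
    (f : WeakDual ℝ F) (x : E) : |f (S x)| ≤ |f| (T |x|) := by
  have hpos : ∀ u : E, 0 ≤ u → |f (S u)| ≤ |f| (T u) := by
    intro u hu
    have hSu : 0 ≤ S u := hS u hu
    have h1 : f (S u) ≤ |f| (S u) := dual_le_iff.1 (le_abs_self f) _ hSu
    have h2 : -f (S u) ≤ |f| (S u) := dual_le_iff.1 (neg_le_abs f) _ hSu
    have h3 := dual_abs_nonneg f (sub_nonneg.2 (hST u hu))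
    rw [map_sub] at h3
    exact (abs_le'.2 ⟨h1, h2⟩).trans (sub_nonneg.1 h3)
  have h1 := hpos x⁺ (posPart_nonneg x)
  have h2 := hpos x⁻ (negPart_nonneg x)
  rw [← posPart_add_negPart x, map_add, map_add]
  conv_lhs => rw [← posPart_sub_negPart x, map_sub, map_sub]
  exact (abs_sub _ _).trans (add_le_add h1 h2)

theorem isDisjointSeq_abs {f : ℕ → WeakDual ℝ F} (hf : IsDisjointSeq f) :
    IsDisjointSeq fun n => |f n| := by
  intro n m hnm
  simpa only [abs_abs] using hf n m hnm

end Dual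

end BanachLattice

/-! ### The domination theorem -/

theorem mainTheorem5 {E F : Type*}
    [NormedAddCommGroup E] [NormedSpace ℝ E] [CompleteSpace E]
    [Lattice E] [IsOrderedAddMonoid E] [IsOrderedModule ℝ E] [HasSolidNorm E]
    [NormedAddCommGroup F] [NormedSpace ℝ F] [CompleteSpace F]
    [Lattice F] [IsOrderedAddMonoid F] [IsOrderedModule ℝ F] [HasSolidNorm F]
    (hF : BanachLattice.PropertyD F)
    (S T : E →L[ℝ] F)
    (hS : BanachLattice.OperatorLE 0 S)
    (hST : BanachLattice.OperatorLE S T)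
    (hT : BanachLattice.IsWeakAlmostLimited T) :
    BanachLattice.IsWeakAlmostLimited S := by
  open BanachLattice in
  intro A hA
  refine ⟨S.lipschitz.isBounded_image hA.isBounded, fun f hfd hf0 => ?_⟩
  -- Property (d) enters only here.
  have hg0 := hF f hfd hf0
  have hgd := isDisjointSeq_abs hfd
  have hTpos : ∀ x : E, 0 ≤ x → 0 ≤ T x := fun x hx => (hS x hx).trans (hST x hx)
  rw [Metric.tendstoUniformlyOn_iff]
  by_contra hcon
  push Not at hcon
  obtain ⟨ε, hε, hfreq⟩ := hcon
  obtain ⟨ns, hns, hP⟩ := extraction_of_frequently_atTop hfreq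
  have hP' : ∀ n, ∃ x ∈ A, ε ≤ |f (ns n) (S x)| := by
    intro n
    obtain ⟨_, ⟨x, hx, rfl⟩, h⟩ := hP n
    rw [dist_comm, Real.dist_0_eq_abs] at h
    exact ⟨x, hx, h⟩
  choose x hxA hx using hP'
  obtain ⟨M, hM⟩ := isBounded_iff_forall_norm_le.1 hA.isBounded
  obtain ⟨k, hk, y, hy0, hyz, hyd, hev⟩ := exists_disjoint_subseq
    (φ := fun n => (WeakDual.toStrongDual |f (ns n)|).comp T)
    (fun n u hu => dual_abs_nonneg _ (hTpos u hu))
    (fun u => (hg0.tendsto_apply (T u)).comp hns.tendsto_atTop)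
    (z := fun n => |x n|) (fun n => abs_nonneg _)
    (fun n => (norm_abs_eq_norm (x n)).trans_le (hM _ (hxA n))) hε
    (fun n => (hx n).trans (abs_apply_map_le hS hST _ _))
  have hwn := tendsto_apply_of_disjoint hA (fun i => hxA (k i)) hy0 hyz hyd
  -- The hypothesis on T is applied to the moduli |f n|, themselves disjoint and weak* null.
  have hunif := (hT _ (isRelativelyWeaklyCompact_range hwn)).2 _ hgd hg0
  rw [Metric.tendstoUniformlyOn_iff] at hunif
  obtain ⟨i, hi1, hi2⟩ := (hev.and
    ((hns.comp hk).tendsto_atTop.eventually (hunif (ε / 2) (half_pos hε)))).exists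
  have h3 := hi2 (T (y i)) ⟨y i, ⟨i, rfl⟩, rfl⟩
  rw [dist_comm, Real.dist_0_eq_abs] at h3
  exact absurd hi1 (not_le.2 ((le_abs_self _).trans_lt h3))
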